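/- Let $n$ be a natural number and let $P$ be a non-empty, finite set of primes. For $1\le r,s\le n$ and $q\in\mathbb{Q}$ let $\theta_{rs}(q)$ be the $n\times n$ matrix whose $(r,s)$ entry is $q$ and whose other entries are those of the identity matrix. Let $$K_P=\{\theta_{rs}(1)^{\pm1} : 1\le r<s\le n\}\cup\{\theta_{rr}(p)^{\pm1} : p\in P,\ 1\le r\le n\},$$ let $FG_n(P)$ be the subgroup of $GL_n(\mathbb{Q})$ generated by $K_P$, regarded as a discrete group, and let $|f|_{K_P}$ be the word length of $f\in FG_n(P)$ with respect to $K_P$. The adelic length of $f\in GL_n(\mathbb{Q})$ is $$|f|_a=\sum_{p}\left(\ln^+\|f\|_p+\ln^+\|f^{-1}\|_p\right),$$ where $p$ runs over all primes and $p=\infty$, $\ln^+=\max\{0,\ln\}$, and $\|f\|_p=\sup_{|v|_p=1}|fv|_p$ is the operator norm on $\mathbb{Q}_p^n$ with the maximum norm $|v|_p=\max_i|v_i|_p$ if $p$ is a prime, and on $\mathbb{R}^n$ with the Euclidean norm if $p=\infty$. Let $\mu$ be a probability measure on $FG_n(P)$. Then $\mu$ has finite first moment with respect to word length if and only if it has finite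 first moment with respect to adelic length, that is, $$\int_{FG_n(P)}|f|_{K_P}\,d\mu(f)<\infty\quad\Longleftrightarrow\quad\int_{FG_n(P)}|f|_a\,d\mu(f)<\infty .$$ -/

import Mathlib

open MeasureTheory
open scoped ENNReal Matrix MatrixGroups

namespace AdelicLength

/-- The matrix `θ_{rs}(q)`: the entry at `(r, s)` is `q`, all other entries are those of the
identity matrix. -/
def theta {n : ℕ} (r s : Fin n) (q : ℚ) : Matrix (Fin n) (Fin n) ℚ :=
  Matrix.of fun i j => if i = r ∧ j = s then q else if i = j then 1 else 0

/-- The matrices `θ_{rs}(q)`, `r ≠ s`, and `θ_{rr}(q)`, `q ≠ 0`, are invertible, so that every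
matrix mentioned in `upperGen` and `diagGen` is indeed (the value of) an element of `GL_n(ℚ)`. -/
theorem isUnit_theta {n : ℕ} (r s : Fin n) (q : ℚ) (h : r ≠ s ∨ q ≠ 0) :
    IsUnit (theta r s q) := by
  rw [Matrix.isUnit_iff_isUnit_det, isUnit_iff_ne_zero]
  by_cases hrs : r = s
  · subst hrs
    have hq : q ≠ 0 := h.resolve_left (fun h => h rfl)
    have : theta r r q = Matrix.diagonal (fun i => if i = r then q else 1) := by
      ext i j
      simp only [theta, Matrix.of_apply, Matrix.diagonal_apply]
      grind
    rw [this, Matrix.det_diagonal, Finset.prod_ne_zero_iff]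
    intro i _
    split_ifs <;> simp [hq]
  · have : theta r s q = Matrix.transvection r s q := by
      ext i j
      simp only [theta, Matrix.of_apply, Matrix.transvection, Matrix.add_apply, Matrix.one_apply,
        Matrix.single_apply]
      grind
    rw [this, Matrix.det_transvection_of_ne _ _ hrs]
    exact one_ne_zero

/-- `U`: the matrices `θ_{rs}(1)` with `r < s`, and their inverses. -/
def upperGen (n : ℕ) : Set (GL (Fin n) ℚ) :=
  {g | ∃ r s : Fin n, r < s ∧ ((g : Matrix (Fin n) (Fin n) ℚ) = theta r s 1 ∨
    ((g⁻¹ : GL (Fin n) ℚ) : Matrix (Fin n) (Fin n) ℚ) = theta r s 1)}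

/-- `J_P`: the matrices `θ_{rr}(p)` with `p ∈ P`, and their inverses. -/
def diagGen (n : ℕ) (P : Finset Nat.Primes) : Set (GL (Fin n) ℚ) :=
  {g | ∃ r : Fin n, ∃ p ∈ P,
    ((g : Matrix (Fin n) (Fin n) ℚ) = theta r r ((p : ℕ) : ℚ) ∨
    ((g⁻¹ : GL (Fin n) ℚ) : Matrix (Fin n) (Fin n) ℚ) = theta r r ((p : ℕ) : ℚ))}

/-- The symmetric generating set `K_P = U ∪ J_P`. -/
def genSet (n : ℕ) (P : Finset Nat.Primes) : Set (GL (Fin n) ℚ) :=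
  upperGen n ∪ diagGen n P

/-- `FG_n(P)`: the subgroup of `GL_n(ℚ)` generated by `K_P`. -/
def FG (n : ℕ) (P : Finset Nat.Primes) : Subgroup (GL (Fin n) ℚ) :=
  Subgroup.closure (genSet n P)

/-- The length of a shortest word in the letters `K_P` that represents `f ∈ FG_n(P)`. -/
noncomputable def wordLength {n : ℕ} {P : Finset Nat.Primes} (f : FG n P) : ℕ :=
  sInf {m : ℕ | ∃ w : List (GL (Fin n) ℚ),
    (∀ g ∈ w, g ∈ genSet n P) ∧ w.prod = (f : GL (Fin n) ℚ) ∧ w.length = m}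

/-- The set in the definition of `wordLength` is never empty. -/
theorem exists_word {n : ℕ} {P : Finset Nat.Primes} (f : FG n P) :
    ∃ w : List (GL (Fin n) ℚ),
      (∀ g ∈ w, g ∈ genSet n P) ∧ w.prod = (f : GL (Fin n) ℚ) := by
  have hf : (f : GL (Fin n) ℚ) ∈ Submonoid.closure (genSet n P ∪ (genSet n P)⁻¹) := by
    rw [← Subgroup.closure_toSubmonoid]
    exact f.2
  obtain ⟨w, hw, hp⟩ := Submonoid.exists_list_of_mem_closure hf
  refine ⟨w, fun g hg => ?_, hp⟩
  rcases hw g hg with h | h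
  · exact h
  · rcases h with ⟨r, s, hrs, h⟩ | ⟨r, p, hp, h⟩
    · exact Or.inl ⟨r, s, hrs, by simpa only [inv_inv] using h.symm⟩
    · exact Or.inr ⟨r, p, hp, by simpa only [inv_inv] using h.symm⟩

instance factPrime (p : Nat.Primes) : Fact (Nat.Prime (p : ℕ)) := ⟨p.2⟩

/-- The `p`-adic operator norm `sup {|A v|_p : v ∈ ℚ_p^n, |v|_p = 1}`; the norm on
`Fin n → ℚ_[p]` is the maximum norm. -/
noncomputable def padicOpNorm {n : ℕ} (p : Nat.Primes) (A : Matrix (Fin n) (Fin n) ℚ) : ℝ :=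
  sSup {c : ℝ | ∃ v : Fin n → ℚ_[(p : ℕ)],
    ‖v‖ = 1 ∧ c = ‖A.map (fun q : ℚ => (q : ℚ_[(p : ℕ)])) *ᵥ v‖}

/-- The real operator norm `sup {|A v|_∞ : v ∈ ℝ^n, |v|_∞ = 1}`, with the Euclidean norm. -/
noncomputable def realOpNorm {n : ℕ} (A : Matrix (Fin n) (Fin n) ℚ) : ℝ :=
  sSup {c : ℝ | ∃ v : EuclideanSpace ℝ (Fin n),
    ‖v‖ = 1 ∧ c = ‖Matrix.toEuclideanLin (A.map (fun q : ℚ => (q : ℝ))) v‖}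

/-- The adelic length `∑_{p ∈ {primes} ∪ {∞}} (ln⁺ ‖f‖_p + ln⁺ ‖f⁻¹‖_p)` of `f ∈ GL_n(ℚ)`,
as a sum of nonnegative terms in `[0, ∞]`. -/
noncomputable def adelicLength {n : ℕ} (f : GL (Fin n) ℚ) : ℝ≥0∞ :=
  (∑' p : Nat.Primes, ENNReal.ofReal
    (Real.posLog (padicOpNorm p (f : Matrix (Fin n) (Fin n) ℚ)) +
      Real.posLog (padicOpNorm p ((f⁻¹ : GL (Fin n) ℚ) : Matrix (Fin n) (Fin n) ℚ)))) +
  ENNReal.ofReal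
    (Real.posLog (realOpNorm (f : Matrix (Fin n) (Fin n) ℚ)) +
      Real.posLog (realOpNorm ((f⁻¹ : GL (Fin n) ℚ) : Matrix (Fin n) (Fin n) ℚ)))

/-- `μ` has finite first moment with respect to the length function `ℓ`: `∫ ℓ dμ < ∞`. -/
def HasFiniteFirstMoment {G : Type*} [MeasurableSpace G] (μ : Measure G) (ℓ : G → ℝ≥0∞) : Prop :=
  ∫⁻ g, ℓ g ∂μ < ∞

end AdelicLength

/-! The two lengths agree up to constants: the adelic length is at most `C` times the word length
(`exists_adelicLength_le`), and the word length is at most `C` times the adelic length plus one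
(`exists_wordLength_le`). The additive constant is harmless because `μ` has finite mass.

The first bound holds because operator norms are submultiplicative at every place, so the adelic
length is subadditive, and the finitely many generators have finite adelic length.

For the second, every element of the group is upper triangular over `ℤ[1/P]` with positive unit
diagonal (`isPTriangular_coe`), hence a product of at most `n²` elementary matrices whose parameters
are its own entries (`hasWord_truncation`). Each factor has a word of length logarithmic in
numerator and denominator: diagonal factors by prime factorization, unipotent ones because
conjugation by `θ_{rr}(p)` multiplies the parameter by `p`, so that base-`p` digits suffice.
Finally, these logarithms are controlled by the norms at `P` and at infinity
(`IsPTriangular.log_entry_le`); the norms of the inverse are not needed. -/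

namespace AdelicLength

open Real

variable {n : ℕ}

/-! ### The `p`-adic operator norm is the largest `p`-adic norm of an entry -/

/-- The ultrametric inequality leaves no factor depending on `n`, so a matrix that is integral at
`p` contributes exactly `0` at `p`. This makes the adelic sum finite. -/
theorem padicOpNorm_le (p : Nat.Primes) (A : Matrix (Fin n) (Fin n) ℚ) {c : ℝ} (hc : 0 ≤ c)
    (h : ∀ i j, ‖(A i j : ℚ_[(p : ℕ)])‖ ≤ c) : padicOpNorm p A ≤ c := by
  refine Real.sSup_le ?_ hc
  rintro _ ⟨v, hv, rfl⟩
  refine (pi_norm_le_iff_of_nonneg hc).2 fun i => ?_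
  rw [Matrix.mulVec, dotProduct]
  refine IsUltrametricDist.norm_sum_le_of_forall_le_of_nonneg hc fun j _ => ?_
  rw [norm_mul]
  calc _ ≤ c * 1 := mul_le_mul (h i j) (hv ▸ norm_le_pi_norm v j) (norm_nonneg _) hc
    _ = c := mul_one c

theorem norm_entry_le_padicOpNorm (p : Nat.Primes) (A : Matrix (Fin n) (Fin n) ℚ) (i j : Fin n) :
    ‖(A i j : ℚ_[(p : ℕ)])‖ ≤ padicOpNorm p A := by
  -- An unbounded set would have `sSup` equal to `0`, so some bound is needed; the sum of all entry
  -- norms is crude but enough.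
  have hb : BddAbove {c : ℝ | ∃ v : Fin n → ℚ_[(p : ℕ)],
      ‖v‖ = 1 ∧ c = ‖A.map (fun q : ℚ => (q : ℚ_[(p : ℕ)])) *ᵥ v‖} := by
    refine ⟨∑ i, ∑ j, ‖(A i j : ℚ_[(p : ℕ)])‖, ?_⟩
    rintro _ ⟨v, hv, rfl⟩
    refine (pi_norm_le_iff_of_nonneg (by positivity)).2 fun i => ?_
    refine le_trans ?_ (Finset.single_le_sum (f := fun i => ∑ j, ‖(A i j : ℚ_[(p : ℕ)])‖)
      (fun i _ => by positivity) (Finset.mem_univ i))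
    rw [Matrix.mulVec, dotProduct]
    refine (norm_sum_le _ _).trans (Finset.sum_le_sum fun j _ => ?_)
    rw [norm_mul]
    exact mul_le_of_le_one_right (norm_nonneg _) (hv ▸ norm_le_pi_norm v j)
  have hv : ‖(Pi.single j 1 : Fin n → ℚ_[(p : ℕ)])‖ = 1 := by
    rw [Pi.norm_single, norm_one]
  refine le_trans ?_ (le_csSup hb ⟨Pi.single j 1, hv, rfl⟩)
  refine le_trans (le_of_eq ?_) (norm_le_pi_norm _ i)
  rw [Matrix.mulVec_single_one, Matrix.col_apply, Matrix.map_apply]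

theorem padicOpNorm_nonneg (p : Nat.Primes) (A : Matrix (Fin n) (Fin n) ℚ) :
    0 ≤ padicOpNorm p A := by
  refine Real.sSup_nonneg ?_
  rintro _ ⟨v, -, rfl⟩
  exact norm_nonneg _

theorem padicOpNorm_mul_le (p : Nat.Primes) (A B : Matrix (Fin n) (Fin n) ℚ) :
    padicOpNorm p (A * B) ≤ padicOpNorm p A * padicOpNorm p B := by
  have hc := mul_nonneg (padicOpNorm_nonneg p A) (padicOpNorm_nonneg p B)
  refine padicOpNorm_le p _ hc fun i j => ?_
  rw [Matrix.mul_apply, Rat.cast_sum]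
  refine IsUltrametricDist.norm_sum_le_of_forall_le_of_nonneg hc fun k _ => ?_
  rw [Rat.cast_mul, norm_mul]
  exact mul_le_mul (norm_entry_le_padicOpNorm p A i k) (norm_entry_le_padicOpNorm p B k j)
    (norm_nonneg _) (padicOpNorm_nonneg p A)

/-! ### The real operator norm -/

/-- Gives access to submultiplicativity of the norm of continuous linear maps. For `n = 0` there are
no unit vectors and both sides are `0`. -/
theorem realOpNorm_eq (A : Matrix (Fin n) (Fin n) ℚ) :
    realOpNorm A =
      ‖Matrix.toEuclideanCLM (n := Fin n) (𝕜 := ℝ) (A.map (fun q : ℚ => (q : ℝ)))‖ := by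
  set T := Matrix.toEuclideanCLM (n := Fin n) (𝕜 := ℝ) (A.map (fun q : ℚ => (q : ℝ))) with hT
  have hle : ∀ c ∈ {c : ℝ | ∃ v : EuclideanSpace ℝ (Fin n),
      ‖v‖ = 1 ∧ c = ‖Matrix.toEuclideanLin (A.map (fun q : ℚ => (q : ℝ))) v‖}, c ≤ ‖T‖ := by
    rintro _ ⟨v, hv, rfl⟩
    exact (T.le_opNorm v).trans (by rw [hv, mul_one])
  have h0 : 0 ≤ realOpNorm A := by
    refine Real.sSup_nonneg ?_
    rintro _ ⟨v, -, rfl⟩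
    exact norm_nonneg _
  refine le_antisymm (Real.sSup_le hle (norm_nonneg _)) ?_
  refine T.opNorm_le_of_unit_norm h0 fun v hv => ?_
  exact le_csSup ⟨_, hle⟩ ⟨v, hv, rfl⟩

theorem abs_entry_le_realOpNorm (A : Matrix (Fin n) (Fin n) ℚ) (i j : Fin n) :
    |(A i j : ℝ)| ≤ realOpNorm A := by
  rw [realOpNorm_eq]
  set T := Matrix.toEuclideanCLM (n := Fin n) (𝕜 := ℝ) (A.map (fun q : ℚ => (q : ℝ))) with hT
  have h := T.le_opNorm (EuclideanSpace.single j 1)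
  rw [PiLp.norm_single, norm_one, mul_one] at h
  refine le_trans ?_ ((PiLp.norm_apply_le _ i).trans h)
  refine le_of_eq ?_
  rw [← Real.norm_eq_abs]
  congr 1
  simp [hT, EuclideanSpace.single]

theorem realOpNorm_nonneg (A : Matrix (Fin n) (Fin n) ℚ) : 0 ≤ realOpNorm A := by
  rw [realOpNorm_eq]
  exact norm_nonneg _

theorem realOpNorm_mul_le (A B : Matrix (Fin n) (Fin n) ℚ) :
    realOpNorm (A * B) ≤ realOpNorm A * realOpNorm B := by
  rw [realOpNorm_eq, realOpNorm_eq, realOpNorm_eq]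
  have : (A * B).map (fun q : ℚ => (q : ℝ)) =
      A.map (fun q : ℚ => (q : ℝ)) * B.map (fun q : ℚ => (q : ℝ)) :=
    Matrix.map_mul (f := Rat.castHom ℝ)
  rw [this, map_mul]
  exact norm_mul_le _ _

/-! ### The adelic length -/

theorem posLog_le_add {x a b : ℝ} (hx : 0 ≤ x) (h : x ≤ a * b) :
    posLog x ≤ posLog a + posLog b :=
  (posLog_le_posLog hx h).trans posLog_mul

theorem adelicLength_mul_le (f g : GL (Fin n) ℚ) :
    adelicLength (f * g) ≤ adelicLength f + adelicLength g := by
  have key : ∀ N : Matrix (Fin n) (Fin n) ℚ → ℝ, (∀ A, 0 ≤ N A) →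
      (∀ A B, N (A * B) ≤ N A * N B) →
      ENNReal.ofReal (posLog (N (f * g : GL (Fin n) ℚ)) +
        posLog (N ((f * g)⁻¹ : GL (Fin n) ℚ))) ≤
      ENNReal.ofReal (posLog (N f) + posLog (N (f⁻¹ : GL (Fin n) ℚ))) +
      ENNReal.ofReal (posLog (N g) + posLog (N (g⁻¹ : GL (Fin n) ℚ))) := by
    intro N hN hmul
    rw [← ENNReal.ofReal_add (add_nonneg posLog_nonneg posLog_nonneg)
      (add_nonneg posLog_nonneg posLog_nonneg), mul_inv_rev, Units.val_mul, Units.val_mul]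
    refine ENNReal.ofReal_le_ofReal ?_
    have h1 := posLog_le_add (hN _) (hmul f g)
    have h2 := posLog_le_add (hN _) (hmul (g⁻¹ : GL (Fin n) ℚ) (f⁻¹ : GL (Fin n) ℚ))
    linarith
  unfold adelicLength
  refine (add_le_add (ENNReal.tsum_le_tsum fun p => key (padicOpNorm p) (padicOpNorm_nonneg p)
    (padicOpNorm_mul_le p)) (key realOpNorm realOpNorm_nonneg realOpNorm_mul_le)).trans ?_
  rw [ENNReal.tsum_add]
  exact le_of_eq (by abel)

theorem adelicLength_one : adelicLength (1 : GL (Fin n) ℚ) = 0 := by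
  have h1 : ∀ p : Nat.Primes, posLog (padicOpNorm p (1 : Matrix (Fin n) (Fin n) ℚ)) = 0 := by
    intro p
    rw [posLog_eq_zero_iff, abs_of_nonneg (padicOpNorm_nonneg _ _)]
    refine padicOpNorm_le p _ zero_le_one fun i j => ?_
    rw [Matrix.one_apply]
    split_ifs <;> simp
  have h2 : posLog (realOpNorm (1 : Matrix (Fin n) (Fin n) ℚ)) = 0 := by
    rw [posLog_eq_zero_iff, abs_of_nonneg (realOpNorm_nonneg _), realOpNorm_eq,
      Matrix.map_one _ Rat.cast_zero Rat.cast_one, map_one]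
    exact ContinuousLinearMap.norm_id_le
  simp [adelicLength, h1, h2]

theorem adelicLength_lt_top (S : Finset Nat.Primes) (f : GL (Fin n) ℚ)
    (h : ∀ p ∉ S, ∀ i j, ‖((f : Matrix (Fin n) (Fin n) ℚ) i j : ℚ_[(p : ℕ)])‖ ≤ 1)
    (h' : ∀ p ∉ S, ∀ i j,
      ‖(((f⁻¹ : GL (Fin n) ℚ) : Matrix (Fin n) (Fin n) ℚ) i j : ℚ_[(p : ℕ)])‖ ≤ 1) :
    adelicLength f < ∞ := by
  refine ENNReal.add_lt_top.2 ⟨?_, ENNReal.ofReal_lt_top⟩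
  rw [tsum_eq_sum (s := S)]
  · exact ENNReal.sum_lt_top.2 fun _ _ => ENNReal.ofReal_lt_top
  · intro p hp
    have key : ∀ A : Matrix (Fin n) (Fin n) ℚ, (∀ i j, ‖(A i j : ℚ_[(p : ℕ)])‖ ≤ 1) →
        posLog (padicOpNorm p A) = 0 := by
      intro A hA
      rw [posLog_eq_zero_iff, abs_of_nonneg (padicOpNorm_nonneg _ _)]
      exact padicOpNorm_le p A zero_le_one hA
    rw [key _ (h p hp), key _ (h' p hp), add_zero, ENNReal.ofReal_zero]

theorem adelicLength_list_prod_le (C : ℝ≥0∞) (w : List (GL (Fin n) ℚ))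
    (h : ∀ g ∈ w, adelicLength g ≤ C) : adelicLength w.prod ≤ C * w.length := by
  induction w with
  | nil => simp [adelicLength_one]
  | cons g w ih =>
    rw [List.prod_cons, List.length_cons, Nat.cast_add, Nat.cast_one, mul_add, mul_one, add_comm]
    refine (adelicLength_mul_le _ _).trans ?_
    exact add_le_add (h g (by simp)) (ih fun g' hg' => h g' (by simp [hg']))

variable {P : Finset Nat.Primes}

/-! ### Elementary matrices -/

theorem theta_self (r : Fin n) (q : ℚ) : theta r r q = Matrix.diagonal (Function.update 1 r q) := by
  ext i j
  simp only [theta, Matrix.of_apply, Matrix.diagonal_apply, Function.update_apply, Pi.one_apply]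
  grind

theorem theta_of_ne {r s : Fin n} (h : r ≠ s) (q : ℚ) : theta r s q = Matrix.transvection r s q := by
  ext i j
  simp only [theta, Matrix.of_apply, Matrix.transvection, Matrix.add_apply, Matrix.one_apply,
    Matrix.single_apply]
  grind

theorem theta_self_one (r : Fin n) : theta r r 1 = 1 := by
  rw [theta_self, Function.update_eq_self_iff.2 (by simp), ← Matrix.diagonal_one]
  rfl

theorem theta_zero {r s : Fin n} (h : r ≠ s) : theta r s 0 = 1 := by
  rw [theta_of_ne h, Matrix.transvection_zero]

theorem theta_self_mul (r : Fin n) (a b : ℚ) :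
    theta r r a * theta r r b = theta r r (a * b) := by
  simp only [theta_self, Matrix.diagonal_mul_diagonal]
  congr 1
  ext i
  simp only [Function.update_apply]
  split_ifs <;> simp

theorem theta_mul {r s : Fin n} (h : r ≠ s) (a b : ℚ) :
    theta r s a * theta r s b = theta r s (a + b) := by
  simp only [theta_of_ne h, Matrix.transvection_mul_transvection_same _ _ h]

/-- The source of the logarithmic bounds: a diagonal conjugation rescales the parameter of a
unipotent matrix. -/
theorem theta_conj {r s : Fin n} (h : r ≠ s) {a : ℚ} (ha : a ≠ 0) (b : ℚ) :
    theta r r a * theta r s b * theta r r a⁻¹ = theta r s (a * b) := by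
  ext i j
  rw [theta_self, theta_self, Matrix.mul_diagonal, Matrix.diagonal_mul]
  simp only [theta, Matrix.of_apply, Function.update_apply, Pi.one_apply]
  split_ifs <;> grind

/-- Left multiplication by `theta r s q` performs a row operation. -/
theorem theta_mul_apply {r s : Fin n} (h : r ≠ s) (q : ℚ) (A : Matrix (Fin n) (Fin n) ℚ)
    (i j : Fin n) : (theta r s q * A) i j = if i = r then A i j + q * A s j else A i j := by
  rw [theta_of_ne h]
  split_ifs with hi
  · rw [hi, Matrix.transvection_mul_apply_same]
  · rw [Matrix.transvection_mul_apply_of_ne _ _ _ _ hi]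

theorem theta_self_mul_apply (r : Fin n) (q : ℚ) (A : Matrix (Fin n) (Fin n) ℚ)
    (i j : Fin n) : (theta r r q * A) i j = if i = r then q * A i j else A i j := by
  rw [theta_self, Matrix.diagonal_mul, Function.update_apply, Pi.one_apply]
  split_ifs <;> simp

theorem theta_mul_eq_one_of_ne {r s : Fin n} (h : r ≠ s) (q : ℚ) :
    theta r s q * theta r s (-q) = 1 := by
  rw [theta_mul h, add_neg_cancel, theta_zero h]

theorem theta_self_mul_eq_one (r : Fin n) {q : ℚ} (hq : q ≠ 0) :
    theta r r q * theta r r q⁻¹ = 1 := by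
  rw [theta_self_mul, mul_inv_cancel₀ hq, theta_self_one]

/-- The values of the generators and of their inverses. -/
theorem coe_of_mem_genSet {g : GL (Fin n) ℚ} (hg : g ∈ genSet n P) :
    (∃ r s : Fin n, r < s ∧ ∃ q : ℚ, (q = 1 ∨ q = -1) ∧
      (g : Matrix (Fin n) (Fin n) ℚ) = theta r s q) ∨
    (∃ r : Fin n, ∃ p ∈ P, ∃ q : ℚ, (q = ((p : ℕ) : ℚ) ∨ q = ((p : ℕ) : ℚ)⁻¹) ∧
      (g : Matrix (Fin n) (Fin n) ℚ) = theta r r q) := by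
  have inv : ∀ {A B : Matrix (Fin n) (Fin n) ℚ},
      ((g⁻¹ : GL (Fin n) ℚ) : Matrix (Fin n) (Fin n) ℚ) = A → A * B = 1 →
      (g : Matrix (Fin n) (Fin n) ℚ) = B := by
    intro A B h hAB
    exact left_inv_eq_right_inv (by rw [← h, ← Units.val_mul, mul_inv_cancel, Units.val_one]) hAB
  rcases hg with ⟨r, s, hrs, h | h⟩ | ⟨r, p, hp, h | h⟩
  · exact Or.inl ⟨r, s, hrs, 1, Or.inl rfl, h⟩
  · exact Or.inl ⟨r, s, hrs, -1, Or.inr rfl, inv h (theta_mul_eq_one_of_ne hrs.ne 1)⟩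
  · exact Or.inr ⟨r, p, hp, _, Or.inl rfl, h⟩
  · exact Or.inr ⟨r, p, hp, _, Or.inr rfl,
      inv h (theta_self_mul_eq_one r (Nat.cast_ne_zero.2 p.2.ne_zero))⟩

theorem inv_mem_genSet {g : GL (Fin n) ℚ} (hg : g ∈ genSet n P) : g⁻¹ ∈ genSet n P := by
  rcases hg with ⟨r, s, hrs, h⟩ | ⟨r, p, hp, h⟩
  · exact Or.inl ⟨r, s, hrs, by simpa only [inv_inv] using h.symm⟩
  · exact Or.inr ⟨r, p, hp, by simpa only [inv_inv] using h.symm⟩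

theorem finite_genSet (n : ℕ) (P : Finset Nat.Primes) : (genSet n P).Finite := by
  let T : Finset ℚ := {1, -1} ∪ (P.image fun p : Nat.Primes => ((p : ℕ) : ℚ)) ∪
    (P.image fun p : Nat.Primes => ((p : ℕ) : ℚ)⁻¹)
  have hT : (((fun x : Fin n × Fin n × ℚ => theta x.1 x.2.1 x.2.2) ''
      (Set.univ ×ˢ Set.univ ×ˢ (T : Set ℚ)))).Finite :=
    (Set.finite_univ.prod (Set.finite_univ.prod T.finite_toSet)).image _
  refine (hT.preimage (f := fun g : GL (Fin n) ℚ => (g : Matrix (Fin n) (Fin n) ℚ))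
    Units.val_injective.injOn).subset ?_
  intro g hg
  rcases coe_of_mem_genSet hg with ⟨r, s, -, q, hq, h⟩ | ⟨r, p, hp, q, hq, h⟩
  · refine ⟨(r, s, q), ⟨trivial, trivial, ?_⟩, h.symm⟩
    rcases hq with rfl | rfl <;> simp [T]
  · refine ⟨(r, r, q), ⟨trivial, trivial, ?_⟩, h.symm⟩
    simp only [T, Finset.coe_union, Finset.coe_image, Set.mem_union, Set.mem_image]
    rcases hq with rfl | rfl
    · exact Or.inl (Or.inr ⟨p, hp, rfl⟩)
    · exact Or.inr ⟨p, hp, rfl⟩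

/-! ### Words -/

/-- The matrix `A` is represented by a word in the letters `K_P` of length at most `m`. -/
def HasWord (P : Finset Nat.Primes) (A : Matrix (Fin n) (Fin n) ℚ) (m : ℝ) : Prop :=
  ∃ w : List (GL (Fin n) ℚ), (∀ g ∈ w, g ∈ genSet n P) ∧
    ((w.prod : GL (Fin n) ℚ) : Matrix (Fin n) (Fin n) ℚ) = A ∧ (w.length : ℝ) ≤ m

theorem hasWord_one : HasWord P (1 : Matrix (Fin n) (Fin n) ℚ) 0 := ⟨[], by simp⟩

theorem HasWord.mono {A : Matrix (Fin n) (Fin n) ℚ} {a b : ℝ} (h : HasWord P A a) (hab : a ≤ b) :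
    HasWord P A b := by
  obtain ⟨w, h1, h2, h3⟩ := h
  exact ⟨w, h1, h2, h3.trans hab⟩

theorem HasWord.mul {A B : Matrix (Fin n) (Fin n) ℚ} {a b : ℝ} (hA : HasWord P A a)
    (hB : HasWord P B b) : HasWord P (A * B) (a + b) := by
  obtain ⟨w, h1, h2, h3⟩ := hA
  obtain ⟨w', h1', h2', h3'⟩ := hB
  refine ⟨w ++ w', fun g hg => ?_, ?_, ?_⟩
  · rcases List.mem_append.1 hg with h | h
    exacts [h1 g h, h1' g h]
  · rw [List.prod_append, Units.val_mul, h2, h2']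
  · rw [List.length_append, Nat.cast_add]
    exact add_le_add h3 h3'

theorem hasWord_of_mem {g : GL (Fin n) ℚ} (hg : g ∈ genSet n P) :
    HasWord P (g : Matrix (Fin n) (Fin n) ℚ) 1 :=
  ⟨[g], by simpa using hg, by simp, by simp⟩

theorem HasWord.wordLength_le {f : FG n P} {m : ℝ}
    (h : HasWord P ((f : GL (Fin n) ℚ) : Matrix (Fin n) (Fin n) ℚ) m) : (wordLength f : ℝ) ≤ m := by
  obtain ⟨w, h1, h2, h3⟩ := h
  refine le_trans (Nat.cast_le.2 (Nat.sInf_le ⟨w, h1, Units.ext h2, rfl⟩)) h3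

theorem exists_word_length_eq (f : FG n P) : ∃ w : List (GL (Fin n) ℚ),
    (∀ g ∈ w, g ∈ genSet n P) ∧ w.prod = (f : GL (Fin n) ℚ) ∧ w.length = wordLength f := by
  obtain ⟨w, h1, h2⟩ := exists_word f
  exact Nat.sInf_mem (s := {m : ℕ | ∃ w : List (GL (Fin n) ℚ),
    (∀ g ∈ w, g ∈ genSet n P) ∧ w.prod = (f : GL (Fin n) ℚ) ∧ w.length = m}) ⟨_, w, h1, h2, rfl⟩

theorem hasWord_pair {A B : Matrix (Fin n) (Fin n) ℚ} (hA : IsUnit A) (hAB : A * B = 1)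
    (h : ∀ g : GL (Fin n) ℚ, (g : Matrix (Fin n) (Fin n) ℚ) = A → g ∈ genSet n P) :
    HasWord P A 1 ∧ HasWord P B 1 := by
  obtain ⟨g, rfl⟩ := hA
  have hg := h g rfl
  refine ⟨hasWord_of_mem hg, ?_⟩
  rw [← Units.inv_eq_of_mul_eq_one_right hAB]
  exact hasWord_of_mem (inv_mem_genSet hg)

theorem hasWord_theta_one {r s : Fin n} (h : r < s) :
    HasWord P (theta r s 1) 1 ∧ HasWord P (theta r s (-1)) 1 :=
  hasWord_pair (isUnit_theta r s 1 (Or.inl h.ne)) (theta_mul_eq_one_of_ne h.ne 1)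
    fun _ hg => Or.inl ⟨r, s, h, Or.inl hg⟩

theorem hasWord_theta_prime (r : Fin n) {p : Nat.Primes} (hp : p ∈ P) :
    HasWord P (theta r r ((p : ℕ) : ℚ)) 1 ∧ HasWord P (theta r r ((p : ℕ) : ℚ)⁻¹) 1 := by
  have h0 : ((p : ℕ) : ℚ) ≠ 0 := Nat.cast_ne_zero.2 p.2.ne_zero
  exact hasWord_pair (isUnit_theta r r _ (Or.inr h0)) (theta_self_mul_eq_one r h0)
    fun _ hg => Or.inr ⟨r, p, hp, Or.inl hg⟩

theorem hasWord_theta_nat_mul {r s : Fin n} (h : r < s) {ε : ℚ} (hε : HasWord P (theta r s ε) 1)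
    (k : ℕ) : HasWord P (theta r s (k * ε)) k := by
  induction k with
  | zero =>
    rw [Nat.cast_zero, zero_mul, theta_zero h.ne, Nat.cast_zero]
    exact hasWord_one
  | succ k ih =>
    rw [Nat.cast_succ, add_mul, one_mul, ← theta_mul h.ne, Nat.cast_succ]
    exact ih.mul hε

/-- Horner's scheme in base `p`. -/
theorem hasWord_theta_nat_mul_log {r s : Fin n} (h : r < s) {ε : ℚ}
    (hε : HasWord P (theta r s ε) 1) {p : Nat.Primes} (hp : p ∈ P) (k : ℕ) :
    HasWord P (theta r s (k * ε)) (((p : ℕ) + 2) * (Nat.log p k + 1)) := by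
  induction k using Nat.strong_induction_on with
  | _ k ih =>
    have hp2 : 1 < (p : ℕ) := p.2.one_lt
    rcases lt_or_ge k p with hk | hk
    · refine (hasWord_theta_nat_mul h hε k).mono ?_
      rw [Nat.log_of_lt hk]
      have : (k : ℝ) ≤ (p : ℕ) := by exact_mod_cast hk.le
      push_cast
      linarith
    · have h1 := ih (k / p) (Nat.div_lt_self (by omega) hp2)
      have h2 := hasWord_theta_nat_mul h hε (k % p)
      -- With `k = p * (k / p) + k % p`, each digit costs two letters for the conjugation and fewer
      -- than `p` for the remainder, hence the factor `p + 2`.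
      have h3 := (((hasWord_theta_prime r hp).1.mul h1).mul (hasWord_theta_prime r hp).2).mul h2
      have h0 : ((p : ℕ) : ℚ) ≠ 0 := Nat.cast_ne_zero.2 p.2.ne_zero
      have hk' : ((p : ℕ) : ℚ) * ((k / p : ℕ) * ε) + (k % p : ℕ) * ε = k * ε := by
        conv_rhs => rw [← Nat.div_add_mod k p]
        push_cast
        ring
      rw [theta_conj h.ne h0, theta_mul h.ne, hk'] at h3
      refine h3.mono ?_
      rw [Nat.log_of_one_lt_of_le hp2 hk]
      have : ((k % p : ℕ) : ℝ) ≤ (p : ℕ) := by exact_mod_cast (Nat.mod_lt k (by omega)).le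
      push_cast at this ⊢
      linarith

theorem hasWord_theta_int {r s : Fin n} (h : r < s) {p : Nat.Primes} (hp : p ∈ P) (a : ℤ) :
    HasWord P (theta r s a) (((p : ℕ) + 2) * (log |(a : ℝ)| / log 2 + 1)) := by
  have hle : (((p : ℕ) + 2) * (Nat.log p a.natAbs + 1) : ℝ) ≤
      ((p : ℕ) + 2) * (log |(a : ℝ)| / log 2 + 1) := by
    refine mul_le_mul_of_nonneg_left (add_le_add_left ?_ 1) (by positivity)
    have h1 : (Nat.log p a.natAbs : ℝ) ≤ Nat.log 2 a.natAbs :=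
      Nat.cast_le.2 (Nat.log_anti_left (by norm_num) p.2.two_le)
    refine h1.trans ((natLog_le_logb _ _).trans (le_of_eq ?_))
    rw [Real.logb, Nat.cast_natAbs, Int.cast_abs, Nat.cast_ofNat]
  rcases le_total 0 a with ha | ha
  · have := hasWord_theta_nat_mul_log h (hasWord_theta_one h).1 hp a.natAbs
    rw [Nat.cast_natAbs, abs_of_nonneg ha, mul_one] at this
    exact this.mono hle
  · have := hasWord_theta_nat_mul_log h (hasWord_theta_one h).2 hp a.natAbs
    rw [Nat.cast_natAbs, abs_of_nonpos ha, Int.cast_neg, neg_mul_neg, mul_one] at this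
    exact this.mono hle

/-- One letter per prime factor; each factor is at least `2`, so there are at most `log₂ m` of them.
-/
theorem hasWord_theta_self_nat (r : Fin n) (m : ℕ) (hm : m ≠ 0)
    (h : ∀ p : Nat.Primes, (p : ℕ) ∣ m → p ∈ P) :
    HasWord P (theta r r m) (log m / log 2) ∧ HasWord P (theta r r (m : ℚ)⁻¹) (log m / log 2) := by
  induction m using induction_on_primes with
  | zero => exact absurd rfl hm
  | one => simp [theta_self_one, hasWord_one]
  | prime_mul p a hp ih =>
    have ha : a ≠ 0 := right_ne_zero_of_mul hm
    obtain ⟨h1, h2⟩ := ih ha fun q hq => h q (hq.mul_left p)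
    obtain ⟨h3, h4⟩ := hasWord_theta_prime r (h ⟨p, hp⟩ (dvd_mul_right p a))
    have hl2 : 0 < log 2 := log_pos one_lt_two
    have hlog : 1 + log a / log 2 ≤ log ((p * a : ℕ) : ℝ) / log 2 := by
      rw [Nat.cast_mul, log_mul (Nat.cast_ne_zero.2 hp.ne_zero) (Nat.cast_ne_zero.2 ha), add_div]
      refine add_le_add_left ?_ _
      rw [one_le_div hl2]
      exact log_le_log two_pos (by exact_mod_cast hp.two_le)
    have h5 := h3.mul h1
    have h6 := h4.mul h2
    rw [theta_self_mul] at h5 h6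
    rw [← mul_inv] at h6
    rw [Nat.cast_mul]
    exact ⟨h5.mono hlog, h6.mono hlog⟩

/-- The word length of an elementary unipotent matrix is at most logarithmic. -/
theorem hasWord_theta_rat {r s : Fin n} (h : r < s) {p : Nat.Primes} (hp : p ∈ P) (q : ℚ)
    (hq : ∀ p : Nat.Primes, (p : ℕ) ∣ q.den → p ∈ P) :
    HasWord P (theta r s q) (2 * (log q.den / log 2) +
      ((p : ℕ) + 2) * (log |(q.num : ℝ)| / log 2 + 1)) := by
  obtain ⟨h1, h2⟩ := hasWord_theta_self_nat r q.den q.den_ne_zero hq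
  have h3 := (h2.mul (hasWord_theta_int h hp q.num)).mul h1
  have hd : (q.den : ℚ) ≠ 0 := Nat.cast_ne_zero.2 q.den_ne_zero
  have h4 := theta_conj h.ne (inv_ne_zero hd) q.num
  rw [inv_inv, inv_mul_eq_div, Rat.num_div_den] at h4
  rw [h4] at h3
  exact h3.mono (by linarith)

theorem hasWord_theta_self_rat (r : Fin n) (q : ℚ) (h0 : 0 < q)
    (hq : ∀ p : Nat.Primes, (p : ℕ) ∣ q.den → p ∈ P)
    (hq' : ∀ p : Nat.Primes, (p : ℕ) ∣ q.num.natAbs → p ∈ P) :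
    HasWord P (theta r r q) (log |(q.num : ℝ)| / log 2 + log q.den / log 2) := by
  have hnum := Rat.num_pos.2 h0
  have h1 := (hasWord_theta_self_nat r q.num.natAbs (Int.natAbs_ne_zero.2 hnum.ne') hq').1
  have h2 := (hasWord_theta_self_nat r q.den q.den_ne_zero hq).2
  have h3 := h1.mul h2
  have hq1 : ((q.num.natAbs : ℕ) : ℚ) = q.num := by rw [Nat.cast_natAbs, abs_of_pos hnum]
  rw [theta_self_mul, hq1, ← div_eq_mul_inv, Rat.num_div_den, Nat.cast_natAbs, Int.cast_abs] at h3
  exact h3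

/-! ### The shape of the elements of `FG_n(P)` -/

/-- Upper triangular matrices over `ℤ[1/P]` whose diagonal entries are positive units. -/
structure IsPTriangular (P : Finset Nat.Primes) (A : Matrix (Fin n) (Fin n) ℚ) : Prop where
  lower : ∀ i j, j < i → A i j = 0
  norm_le : ∀ p ∉ P, ∀ i j, ‖(A i j : ℚ_[(p : ℕ)])‖ ≤ 1
  diag_pos : ∀ i, 0 < A i i
  norm_diag : ∀ p ∉ P, ∀ i, ‖(A i i : ℚ_[(p : ℕ)])‖ = 1

theorem isPTriangular_one : IsPTriangular P (1 : Matrix (Fin n) (Fin n) ℚ) where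
  lower i j h := Matrix.one_apply_ne h.ne'
  norm_le p _ i j := by
    rw [Matrix.one_apply]
    split_ifs <;> simp
  diag_pos i := by simp
  norm_diag p _ i := by simp

theorem norm_prime_eq_one {p q : Nat.Primes} (h : p ≠ q) : ‖((q : ℕ) : ℚ_[(p : ℕ)])‖ = 1 := by
  rw [Padic.norm_natCast_eq_one_iff, Nat.coprime_primes p.2 q.2]
  exact fun h' => h (Subtype.ext h')

theorem IsPTriangular.genSet_mul {A : Matrix (Fin n) (Fin n) ℚ} (hA : IsPTriangular P A)
    {g : GL (Fin n) ℚ} (hg : g ∈ genSet n P) :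
    IsPTriangular P ((g : Matrix (Fin n) (Fin n) ℚ) * A) := by
  rcases coe_of_mem_genSet hg with ⟨r, s, hrs, q, hq, h⟩ | ⟨r, p, hp, q, hq, h⟩
  · rw [h]
    -- Row `s` is added to row `r` with `r < s`, and `A s r = 0` by triangularity.
    have hdiag : ∀ i, (theta r s q * A) i i = A i i := by
      intro i
      rw [theta_mul_apply hrs.ne]
      split_ifs with hi
      · rw [hA.lower s i (hi ▸ hrs), mul_zero, add_zero]
      · rfl
    refine ⟨fun i j hij => ?_, fun p hp i j => ?_, fun i => ?_, fun p hp i => ?_⟩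
    · rw [theta_mul_apply hrs.ne, hA.lower i j hij]
      split_ifs with hi
      · rw [hA.lower s j (hij.trans (hi ▸ hrs)), mul_zero, add_zero]
      · rfl
    · rw [theta_mul_apply hrs.ne]
      split_ifs with hi
      · rw [Rat.cast_add, Rat.cast_mul]
        refine (Padic.nonarchimedean _ _).trans (max_le (hA.norm_le p hp i j) ?_)
        have hq1 : ‖(q : ℚ_[(p : ℕ)])‖ = 1 := by rcases hq with rfl | rfl <;> simp
        rw [norm_mul, hq1, one_mul]
        exact hA.norm_le p hp s j
      · exact hA.norm_le p hp i j
    · rw [hdiag]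
      exact hA.diag_pos i
    · rw [hdiag]
      exact hA.norm_diag p hp i
  · rw [h]
    have hp0 : (0 : ℚ) < ((p : ℕ) : ℚ) := Nat.cast_pos.2 p.2.pos
    have hq0 : 0 < q := by
      rcases hq with rfl | rfl
      exacts [hp0, inv_pos.2 hp0]
    have hq1 : ∀ p' ∉ P, ‖(q : ℚ_[(p' : ℕ)])‖ = 1 := by
      intro p' hp'
      have := norm_prime_eq_one (p := p') (q := p) (fun h => hp' (h ▸ hp))
      rcases hq with rfl | rfl
      · rwa [Rat.cast_natCast]
      · rw [Rat.cast_inv, Rat.cast_natCast, norm_inv, this, inv_one]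
    refine ⟨fun i j hij => ?_, fun p hp i j => ?_, fun i => ?_, fun p hp i => ?_⟩
    · rw [theta_self_mul_apply, hA.lower i j hij, mul_zero, ite_self]
    · rw [theta_self_mul_apply]
      split_ifs
      · rw [Rat.cast_mul, norm_mul, hq1 p hp, one_mul]
        exact hA.norm_le p hp i j
      · exact hA.norm_le p hp i j
    · rw [theta_self_mul_apply]
      split_ifs
      exacts [mul_pos hq0 (hA.diag_pos i), hA.diag_pos i]
    · rw [theta_self_mul_apply]
      split_ifs
      · rw [Rat.cast_mul, norm_mul, hq1 p hp, one_mul]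
        exact hA.norm_diag p hp i
      · exact hA.norm_diag p hp i

theorem isPTriangular_list_prod (w : List (GL (Fin n) ℚ)) (h : ∀ g ∈ w, g ∈ genSet n P) :
    IsPTriangular P ((w.prod : GL (Fin n) ℚ) : Matrix (Fin n) (Fin n) ℚ) := by
  induction w with
  | nil => exact isPTriangular_one
  | cons g w ih =>
    rw [List.prod_cons, Units.val_mul]
    exact (ih fun g' hg' => h g' (by simp [hg'])).genSet_mul (h g (by simp))

theorem isPTriangular_coe (f : FG n P) :
    IsPTriangular P ((f : GL (Fin n) ℚ) : Matrix (Fin n) (Fin n) ℚ) := by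
  obtain ⟨w, h1, h2⟩ := exists_word f
  exact h2 ▸ isPTriangular_list_prod w h1

/-! ### The adelic length is bounded by the word length -/

theorem exists_adelicLength_le (n : ℕ) (P : Finset Nat.Primes) : ∃ C : ℝ≥0∞, C ≠ ∞ ∧
    ∀ f : FG n P, adelicLength (f : GL (Fin n) ℚ) ≤ C * wordLength f := by
  have hfin : ∀ g ∈ genSet n P, adelicLength g < ∞ := by
    have key : ∀ g ∈ genSet n P, IsPTriangular P (g : Matrix (Fin n) (Fin n) ℚ) := fun g hg => by
      simpa using isPTriangular_one.genSet_mul hg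
    exact fun g hg => adelicLength_lt_top P g (key g hg).norm_le
      (key _ (inv_mem_genSet hg)).norm_le
  -- The sum dominates each generator and, unlike a maximum, makes sense when there are no
  -- generators.
  refine ⟨∑ g ∈ (finite_genSet n P).toFinset, adelicLength g, ?_, fun f => ?_⟩
  · exact (ENNReal.sum_lt_top.2 fun g hg =>
      hfin g ((finite_genSet n P).mem_toFinset.1 hg)).ne
  · obtain ⟨w, h1, h2, h3⟩ := exists_word_length_eq f
    rw [← h2, ← h3]
    exact adelicLength_list_prod_le _ w fun g hg =>
      Finset.single_le_sum (f := fun g => adelicLength g) (fun _ _ => zero_le)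
        ((finite_genSet n P).mem_toFinset.2 (h1 g hg))

/-! ### Heights of rational numbers -/

/-- A prime dividing the denominator does not divide the numerator, so it makes the norm of `q`
exceed `1`. -/
theorem mem_of_dvd_den {q : ℚ} (h : ∀ p ∉ P, ‖(q : ℚ_[((p : Nat.Primes) : ℕ)])‖ ≤ 1)
    (p : Nat.Primes) (hp : (p : ℕ) ∣ q.den) : p ∈ P := by
  by_contra hP
  have hnum : ‖((q.num : ℤ) : ℚ_[(p : ℕ)])‖ = 1 := by
    rw [Padic.norm_intCast_eq_one_iff]
    exact Int.isCoprime_iff_gcd_eq_one.2 (Nat.Coprime.coprime_dvd_right hp q.reduced)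
  have hden : ‖((q.den : ℕ) : ℚ_[(p : ℕ)])‖ < 1 := Padic.norm_natCast_lt_one_iff.2 hp
  have h0 : 0 < ‖((q.den : ℕ) : ℚ_[(p : ℕ)])‖ := norm_pos_iff.2 (Nat.cast_ne_zero.2 q.den_ne_zero)
  have := h p hP
  rw [Rat.cast_def, norm_div, hnum, div_le_one h0] at this
  exact absurd hden this.not_gt

theorem mem_of_dvd_num {q : ℚ} (h : ∀ p ∉ P, ‖(q : ℚ_[((p : Nat.Primes) : ℕ)])‖ = 1)
    (p : Nat.Primes) (hp : (p : ℕ) ∣ q.num.natAbs) : p ∈ P := by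
  by_contra hP
  have hnum : ‖((q.num : ℤ) : ℚ_[(p : ℕ)])‖ < 1 :=
    Padic.norm_intCast_lt_one_iff.2 (Int.natCast_dvd.2 hp)
  have hden : ‖((q.den : ℕ) : ℚ_[(p : ℕ)])‖ = 1 := by
    rw [Padic.norm_natCast_eq_one_iff]
    exact Nat.Coprime.coprime_dvd_left hp q.reduced
  have := h p hP
  rw [Rat.cast_def, norm_div, hden, div_one] at this
  exact hnum.ne this

theorem neg_log_norm_prime (p : Nat.Primes) :
    -log ‖((p : ℕ) : ℚ_[(p : ℕ)])‖ = log (p : ℕ) := by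
  rw [Padic.norm_p, log_inv, neg_neg]

/-- The product formula for an integer all of whose prime factors lie in `P`. -/
theorem log_natCast_eq_sum (m : ℕ) (hm : m ≠ 0)
    (h : ∀ p : Nat.Primes, (p : ℕ) ∣ m → p ∈ P) :
    log m = ∑ p ∈ P, -log ‖((m : ℕ) : ℚ_[(p : ℕ)])‖ := by
  induction m using induction_on_primes with
  | zero => exact absurd rfl hm
  | one => simp
  | prime_mul p a hp ih =>
    have ha : a ≠ 0 := right_ne_zero_of_mul hm
    have hp0 := hp.ne_zero
    have hsum : ∑ q ∈ P, -log ‖((p : ℕ) : ℚ_[(q : ℕ)])‖ = log p := by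
      refine (Finset.sum_eq_single_of_mem (⟨p, hp⟩ : Nat.Primes)
        (h ⟨p, hp⟩ (dvd_mul_right p a)) ?_).trans ?_
      · intro q _ hq
        rw [norm_prime_eq_one (q := ⟨p, hp⟩) hq, log_one, neg_zero]
      · exact neg_log_norm_prime ⟨p, hp⟩
    have hterm : ∀ q ∈ P, -log ‖((p * a : ℕ) : ℚ_[(q : ℕ)])‖ =
        -log ‖((p : ℕ) : ℚ_[(q : ℕ)])‖ + -log ‖((a : ℕ) : ℚ_[(q : ℕ)])‖ := by
      intro q _
      rw [Nat.cast_mul, norm_mul, log_mul (norm_ne_zero_iff.2 (Nat.cast_ne_zero.2 hp0))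
        (norm_ne_zero_iff.2 (Nat.cast_ne_zero.2 ha)), neg_add]
    rw [Finset.sum_congr rfl hterm, Finset.sum_add_distrib, hsum,
      ← ih ha fun q hq => h q (hq.mul_left p), Nat.cast_mul,
      log_mul (Nat.cast_ne_zero.2 hp0) (Nat.cast_ne_zero.2 ha)]

theorem neg_log_norm_den_le (q : ℚ) (p : Nat.Primes) :
    -log ‖((q.den : ℕ) : ℚ_[(p : ℕ)])‖ ≤ posLog ‖(q : ℚ_[(p : ℕ)])‖ := by
  by_cases hp : (p : ℕ) ∣ q.den
  · have hnum : ‖((q.num : ℤ) : ℚ_[(p : ℕ)])‖ = 1 := by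
      rw [Padic.norm_intCast_eq_one_iff]
      exact Int.isCoprime_iff_gcd_eq_one.2 (Nat.Coprime.coprime_dvd_right hp q.reduced)
    rw [Rat.cast_def, norm_div, hnum, one_div, ← log_inv]
    exact le_max_right _ _
  · have hden : ‖((q.den : ℕ) : ℚ_[(p : ℕ)])‖ = 1 := by
      rw [Padic.norm_natCast_eq_one_iff]
      exact (p.2.coprime_iff_not_dvd).2 hp
    rw [hden, log_one, neg_zero]
    exact posLog_nonneg

theorem log_den_le (q : ℚ) (h : ∀ p ∉ P, ‖(q : ℚ_[((p : Nat.Primes) : ℕ)])‖ ≤ 1) :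
    log q.den ≤ ∑ p ∈ P, posLog ‖(q : ℚ_[(p : ℕ)])‖ := by
  rw [log_natCast_eq_sum q.den q.den_ne_zero (mem_of_dvd_den h)]
  exact Finset.sum_le_sum fun p _ => neg_log_norm_den_le q p

/-- This is `|num| = |q| * den` in logarithms; at `q = 0` the convention `log 0 = 0` keeps it true.
-/
theorem log_num_le (q : ℚ) : log |(q.num : ℝ)| ≤ posLog |(q : ℝ)| + log q.den := by
  have hd : (0 : ℝ) < q.den := Nat.cast_pos.2 q.den_pos
  by_cases hq : q = 0
  · subst hq
    simp
  · have h1 : (q.num : ℝ) = q * q.den := by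
      have := Rat.cast_def (K := ℝ) q
      rw [this, div_mul_cancel₀ _ hd.ne']
    rw [h1, abs_mul, log_mul (abs_ne_zero.2 (Rat.cast_ne_zero.2 hq)) (abs_ne_zero.2 hd.ne'),
      abs_of_pos hd]
    exact add_le_add_left (le_max_right _ _) _

/-! ### The word length is bounded by the adelic length -/

/-- The contribution of the forward norms at `P` and at infinity to the adelic length. -/
noncomputable def height (P : Finset Nat.Primes) (A : Matrix (Fin n) (Fin n) ℚ) : ℝ :=
  ∑ p ∈ P, posLog (padicOpNorm p A) + posLog (realOpNorm A)

theorem height_nonneg (A : Matrix (Fin n) (Fin n) ℚ) : 0 ≤ height P A :=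
  add_nonneg (Finset.sum_nonneg fun _ _ => posLog_nonneg) posLog_nonneg

theorem IsPTriangular.log_entry_le {A : Matrix (Fin n) (Fin n) ℚ} (hA : IsPTriangular P A)
    (i j : Fin n) :
    log (A i j).den ≤ height P A ∧ log |((A i j).num : ℝ)| ≤ height P A := by
  have h1 := log_den_le (A i j) fun p hp => hA.norm_le p hp i j
  have h2 : ∑ p ∈ P, posLog ‖(A i j : ℚ_[(p : ℕ)])‖ ≤ ∑ p ∈ P, posLog (padicOpNorm p A) :=
    Finset.sum_le_sum fun p _ =>
      posLog_le_posLog (norm_nonneg _) (norm_entry_le_padicOpNorm p A i j)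
  have h3 := log_num_le (A i j)
  have h4 := posLog_le_posLog (abs_nonneg _) (abs_entry_le_realOpNorm A i j)
  have h5 : 0 ≤ posLog (realOpNorm A) := posLog_nonneg
  unfold height
  constructor <;> linarith

/-- Put `H = height P A / log 2`. Diagonal entries cost at most `2H`, the others `2H + (p + 2)(H +
1)`; both are at most `(p + 4)(H + 1)`. -/
theorem IsPTriangular.hasWord_theta {A : Matrix (Fin n) (Fin n) ℚ} (hA : IsPTriangular P A)
    {p : Nat.Primes} (hp : p ∈ P) {i j : Fin n} (hij : i ≤ j) :
    HasWord P (theta i j (A i j)) (((p : ℕ) + 4) * (height P A / log 2 + 1)) := by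
  obtain ⟨h1, h2⟩ := hA.log_entry_le i j
  have hl : 0 < log 2 := log_pos one_lt_two
  have h1' := div_le_div_of_nonneg_right h1 hl.le
  have h2' := div_le_div_of_nonneg_right h2 hl.le
  have h0 : 0 ≤ height P A / log 2 := div_nonneg (height_nonneg A) hl.le
  have hp0 : (0 : ℝ) ≤ (p : ℕ) := Nat.cast_nonneg _
  have hden := mem_of_dvd_den fun p hp => hA.norm_le p hp i j
  rcases hij.eq_or_lt with rfl | hlt
  · refine (hasWord_theta_self_rat i _ (hA.diag_pos i) hden
      (mem_of_dvd_num fun p hp => hA.norm_diag p hp i)).mono ?_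
    have := mul_nonneg hp0 h0
    linarith
  · refine (hasWord_theta_rat hlt hp _ hden).mono ?_
    have := mul_le_mul_of_nonneg_left (add_le_add_left h2' 1)
      (by positivity : (0 : ℝ) ≤ (p : ℕ) + 2)
    linarith

/-- The matrix that agrees with `A` in the rows above row `i` and in the first `k` entries of
row `i`, and with the identity matrix elsewhere. -/
def truncation (A : Matrix (Fin n) (Fin n) ℚ) (i k : ℕ) : Matrix (Fin n) (Fin n) ℚ :=
  Matrix.of fun r c => if (r : ℕ) < i ∨ ((r : ℕ) = i ∧ (c : ℕ) < k) then A r c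
    else (1 : Matrix (Fin n) (Fin n) ℚ) r c

theorem truncation_zero (A : Matrix (Fin n) (Fin n) ℚ) : truncation A 0 0 = 1 := by
  ext r c
  simp [truncation]

theorem truncation_succ_zero (A : Matrix (Fin n) (Fin n) ℚ) (i : ℕ) :
    truncation A (i + 1) 0 = truncation A i n := by
  ext r c
  have : ((r : ℕ) < i + 1 ∨ ((r : ℕ) = i + 1 ∧ (c : ℕ) < 0)) ↔
    ((r : ℕ) < i ∨ ((r : ℕ) = i ∧ (c : ℕ) < n)) := by omega
  simp only [truncation, Matrix.of_apply, this]

theorem truncation_top (A : Matrix (Fin n) (Fin n) ℚ) : truncation A n 0 = A := by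
  ext r c
  simp [truncation]

theorem truncation_succ_of_lt {A : Matrix (Fin n) (Fin n) ℚ} (hA : ∀ i j, j < i → A i j = 0)
    {i k : Fin n} (h : k < i) : truncation A i (k + 1) = truncation A i k := by
  ext r c
  have := hA i k h
  simp only [truncation, Matrix.of_apply, Matrix.one_apply]
  grind

/-- Rows are filled from the top, so for `i < k` row `k` is still that of the identity and the row
operation changes only the entry `(i, k)`. For `i = k`, row `i` is still that of the identity
because `A` vanishes left of the diagonal, and it gets scaled. -/
theorem truncation_succ {A : Matrix (Fin n) (Fin n) ℚ} {i k : Fin n} (h : i ≤ k)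
    (hA : ∀ i j, j < i → A i j = 0) :
    truncation A i (k + 1) = theta i k (A i k) * truncation A i k := by
  ext r c
  rcases h.eq_or_lt with rfl | hlt
  · rw [theta_self_mul_apply]
    have := hA i c
    simp only [truncation, Matrix.of_apply, Matrix.one_apply]
    grind
  · rw [theta_mul_apply hlt.ne]
    simp only [truncation, Matrix.of_apply, Matrix.one_apply]
    grind

/-- An upper triangular matrix is the product of the elementary matrices of its entries. -/
theorem hasWord_truncation {A : Matrix (Fin n) (Fin n) ℚ} (hA : ∀ i j, j < i → A i j = 0) {B : ℝ}
    (h : ∀ i j, i ≤ j → HasWord P (theta i j (A i j)) B) (hB : 0 ≤ B) (i : ℕ) (hi : i ≤ n) :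
    HasWord P (truncation A i 0) (i * n * B) := by
  induction i with
  | zero =>
    rw [truncation_zero, Nat.cast_zero, zero_mul, zero_mul]
    exact hasWord_one
  | succ i ih =>
    have key : ∀ k ≤ n, HasWord P (truncation A i k) (i * n * B + k * B) := by
      intro k
      induction k with
      | zero =>
        intro _
        exact (ih (by omega)).mono (by simp)
      | succ k ihk =>
        intro hk
        have hprev := ihk (by omega)
        rcases lt_or_ge k i with hki | hik
        · rw [truncation_succ_of_lt hA (i := ⟨i, hi⟩) (k := ⟨k, hk⟩) hki]
          refine hprev.mono ?_
          push_cast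
          linarith
        · rw [truncation_succ (i := ⟨i, hi⟩) (k := ⟨k, hk⟩) hik hA]
          refine ((h ⟨i, hi⟩ ⟨k, hk⟩ hik).mul hprev).mono ?_
          push_cast
          linarith
    rw [truncation_succ_zero]
    refine (key n le_rfl).mono ?_
    push_cast
    linarith

theorem ofReal_height_le (f : GL (Fin n) ℚ) :
    ENNReal.ofReal (height P (f : Matrix (Fin n) (Fin n) ℚ)) ≤ adelicLength f := by
  unfold height adelicLength
  rw [ENNReal.ofReal_add (Finset.sum_nonneg fun _ _ => posLog_nonneg) posLog_nonneg,
    ENNReal.ofReal_sum_of_nonneg fun _ _ => posLog_nonneg]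
  refine add_le_add (le_trans (Finset.sum_le_sum fun p _ => ?_) (ENNReal.sum_le_tsum P)) ?_
  · exact ENNReal.ofReal_le_ofReal (le_add_of_nonneg_right posLog_nonneg)
  · exact ENNReal.ofReal_le_ofReal (le_add_of_nonneg_right posLog_nonneg)

theorem exists_wordLength_le (n : ℕ) {P : Finset Nat.Primes} (hP : P.Nonempty) :
    ∃ C : ℝ≥0∞, C ≠ ∞ ∧
      ∀ f : FG n P, (wordLength f : ℝ≥0∞) ≤ C * (adelicLength (f : GL (Fin n) ℚ) + 1) := by
  obtain ⟨p, hp⟩ := hP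
  have hl : 0 < log 2 := log_pos one_lt_two
  -- Here `n * n` bounds the number of factors, and the last factor comes from `h / log 2 + 1 ≤ (1 /
  -- log 2 + 1)(h + 1)` for `h ≥ 0`.
  set c : ℝ := n * n * ((p : ℕ) + 4) * (1 / log 2 + 1) with hc
  have hc0 : 0 ≤ c := by positivity
  refine ⟨ENNReal.ofReal c, ENNReal.ofReal_ne_top, fun f => ?_⟩
  have hA := isPTriangular_coe f
  have h0 := height_nonneg (P := P) ((f : GL (Fin n) ℚ) : Matrix (Fin n) (Fin n) ℚ)
  have hw := hasWord_truncation hA.lower (fun i j hij => hA.hasWord_theta hp hij)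
    (by positivity) n le_rfl
  rw [truncation_top] at hw
  have hle : (wordLength f : ℝ) ≤
      c * (height P ((f : GL (Fin n) ℚ) : Matrix (Fin n) (Fin n) ℚ) + 1) := by
    refine hw.wordLength_le.trans ?_
    rw [hc, ← mul_assoc, mul_assoc _ (1 / log 2 + 1)]
    refine mul_le_mul_of_nonneg_left ?_ (by positivity)
    have : 0 ≤ 1 / log 2 := by positivity
    rw [div_eq_mul_one_div]
    linarith
  calc (wordLength f : ℝ≥0∞) = ENNReal.ofReal (wordLength f : ℝ) := by simp
    _ ≤ ENNReal.ofReal c *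
        (ENNReal.ofReal (height P ((f : GL (Fin n) ℚ) : Matrix (Fin n) (Fin n) ℚ)) + 1) := by
      rw [← ENNReal.ofReal_one, ← ENNReal.ofReal_add h0 zero_le_one, ← ENNReal.ofReal_mul hc0]
      exact ENNReal.ofReal_le_ofReal hle
    _ ≤ _ := mul_le_mul_right (add_le_add_left (ofReal_height_le _) 1) _

end AdelicLength

theorem mainTheorem3 (n : ℕ) (P : Finset Nat.Primes) (hP : P.Nonempty)
    [MeasurableSpace (AdelicLength.FG n P)] [DiscreteMeasurableSpace (AdelicLength.FG n P)]
    (μ : Measure (AdelicLength.FG n P)) [IsProbabilityMeasure μ] :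
    AdelicLength.HasFiniteFirstMoment μ (fun f => (AdelicLength.wordLength f : ℝ≥0∞)) ↔
      AdelicLength.HasFiniteFirstMoment μ
        (fun f => AdelicLength.adelicLength (f : GL (Fin n) ℚ)) := by
  unfold AdelicLength.HasFiniteFirstMoment
  constructor
  · intro h
    obtain ⟨C, hC, hle⟩ := AdelicLength.exists_adelicLength_le n P
    refine (lintegral_mono hle).trans_lt ?_
    rw [lintegral_const_mul' _ _ hC]
    exact ENNReal.mul_lt_top hC.lt_top h
  · intro h
    obtain ⟨C, hC, hle⟩ := AdelicLength.exists_wordLength_le n hP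
    refine (lintegral_mono hle).trans_lt ?_
    -- The additive constant integrates to `1`, the total mass of `μ`.
    rw [lintegral_const_mul' _ _ hC, lintegral_add_right _ measurable_const, lintegral_const,
      measure_univ, mul_one]
    exact ENNReal.mul_lt_top hC.lt_top (ENNReal.add_lt_top.2 ⟨h, ENNReal.one_lt_top⟩)
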